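/- Conventions. A direct limit is a colimit of a diagram indexed by a (nonempty) directed poset; it is countable if the poset is countable. A direct limit of copies of an object $X$ is a direct limit of a diagram all of whose objects are isomorphic to $X$. For a class of objects $\mathsf L$ in a category $\mathsf C$, a morphism $l\colon L\to C$ is an $\mathsf L$-precover of $C$ if $L\in\mathsf L$ and every morphism $L'\to C$ with $L'\in\mathsf L$ factors through $l$; it is an $\mathsf L$-cover if, moreover, every endomorphism $e\colon L\to L$ with $le=l$ is an automorphism. The class $\mathsf L$ is covering in $\mathsf C$ if every object of $\mathsf C$ has an $\mathsf L$-cover. $\mathsf B_{\mathrm{proj}}$ denotes the class of projective objects of $\mathsf B$, and a projective cover is a $\mathsf B_{\mathrm{proj}}$-cover. Let $\mathsf A$ be a locally presentable additive category and $M\in\mathsf A$. For a set $X$ let $M^{(X)}$ be the coproduct of $X$ copies of $M$, and let $\mathrm{Add}(M)$ be the class of all direct summands of the objects $M^{(X)}$. Let $\mathbb T_M\colon X\mapsto \mathrm{Hom}_{\mathsf A}(M,M^{(X)})$ be the monad on the category of sets arising from the adjunction between $X\mapsto M^{(X)}$ and $N\mapsto\mathrm{Hom}_{\mathsf A}(M,N)$,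 let $\mathsf B=\mathbb T_M\text{-}\mathrm{mod}$ be the (locally presentable abelian) category of algebras over $\mathbb T_M$, and let $P=\mathbb T_M(*)\in\mathsf B$ be the free $\mathbb T_M$-algebra with one generator (a projective generator of $\mathsf B$). Assume that $M$ satisfies the telescope Hom exactness condition: for every sequence of endomorphisms $f_1,f_2,f_3,\dots$ of $M$, with $\varinjlim_{n\ge1}M$ the direct limit of $M\xrightarrow{f_1}M\xrightarrow{f_2}M\xrightarrow{f_3}\cdots$, the functor $\mathrm{Hom}_{\mathsf A}(M,-)$ takes the right exact sequence $$\coprod_{n=1}^\infty M\xrightarrow{\ \mathrm{id}-\mathrm{shift}\ }\coprod_{n=1}^\infty M\longrightarrow\varinjlim_{n\ge1}M\longrightarrow0$$ to a right exact sequence of abelian groups, where $\mathrm{shift}$ maps the $n$-th summand to the $(n+1)$-st one by $f_n$. Assume further that the Main Conjecture holds for $\mathsf B$ and $P$, that is, the conditions (6)--(10) below are equivalent to each other. Theorem. Under these assumptions the following ten conditions are equivalent: 1. the class $\mathrm{Add}(M)$ is covering in $\mathsf A$; 2. any direct limit of objects from $\mathrm{Add}(M)$ has an $\mathrm{Add}(M)$-cover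 in $\mathsf A$; 3. any countable direct limit of copies of $M$ has an $\mathrm{Add}(M)$-cover in $\mathsf A$; 4. any countable direct limit of copies of $M$ in $\mathsf A$ belongs to $\mathrm{Add}(M)$; 5. the class $\mathrm{Add}(M)$ is closed under direct limits in $\mathsf A$; 6. the class $\mathsf B_{\mathrm{proj}}$ is covering in $\mathsf B$; 7. any direct limit of projective objects has a projective cover in $\mathsf B$; 8. any countable direct limit of copies of $P$ has a projective cover in $\mathsf B$; 9. any countable direct limit of copies of $P$ is projective in $\mathsf B$; 10. the class $\mathsf B_{\mathrm{proj}}$ is closed under direct limits in $\mathsf B$. -/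

import Mathlib

open CategoryTheory CategoryTheory.Limits

universe v u

namespace EnochsAdd

/-! ## Direct limits, precovers and covers -/

section Classes

variable {C : Type u} [Category.{v} C]

/-- The class of direct limits (colimits of diagrams indexed by nonempty directed posets) in `C` of
diagrams whose objects all belong to the class `L`. -/
def directLimits (L : ObjectProperty C) : ObjectProperty C := fun X =>
  ∃ (Θ : Type v) (_ : PartialOrder Θ) (_ : IsDirectedOrder Θ) (_ : Nonempty Θ),
    L.colimitsOfShape Θ X

/-- The class of countable direct limits (indexed by countable nonempty directed posets) in `C` of
diagrams whose objects all belong to the class `L`. -/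
def countableDirectLimits (L : ObjectProperty C) : ObjectProperty C := fun X =>
  ∃ (Θ : Type v) (_ : PartialOrder Θ) (_ : IsDirectedOrder Θ) (_ : Nonempty Θ) (_ : Countable Θ),
    L.colimitsOfShape Θ X

/-- The class of all copies of an object `M`. -/
def copies (M : C) : ObjectProperty C := fun X => Nonempty (X ≅ M)

/-- `L` is closed under direct limits in `C`. -/
def ClosedUnderDirectLimits (L : ObjectProperty C) : Prop := directLimits L ≤ L

/-- `l : X ⟶ Y` is an `L`-precover of `Y`. -/
structure IsPrecover (L : ObjectProperty C) {X Y : C} (l : X ⟶ Y) : Prop where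
  mem : L X
  factors : ∀ (X' : C) (l' : X' ⟶ Y), L X' → ∃ f : X' ⟶ X, f ≫ l = l'

/-- `l : X ⟶ Y` is an `L`-cover of `Y`. -/
structure IsCover (L : ObjectProperty C) {X Y : C} (l : X ⟶ Y) : Prop extends
    IsPrecover L l where
  isIso : ∀ e : X ⟶ X, e ≫ l = l → IsIso e

/-- The class of objects that have an `L`-cover. -/
def hasCover (L : ObjectProperty C) : ObjectProperty C := fun Y =>
  ∃ (X : C) (l : X ⟶ Y), IsCover L l

/-- Every object of `C` has an `L`-cover. -/
def IsCovering (L : ObjectProperty C) : Prop := ∀ Y : C, hasCover L Y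

end Classes

/-! ## The Main Conjecture for a given category with a given projective generator -/

/-- The assertion of the Main Conjecture for a category `B` (in practice locally presentable and
abelian) and an object `P` of `B` (in practice a projective generator): five properties of the pair
`(B, P)` are equivalent. A projective cover is a cover with respect to the class of
projectives. -/
def MainConjectureHolds (B : Type u) [Category.{v} B] (P : B) : Prop :=
  List.TFAE [
    IsCovering (isProjective B),
    directLimits (isProjective B) ≤ hasCover (isProjective B),
    countableDirectLimits (copies P) ≤ hasCover (isProjective B),
    countableDirectLimits (copies P) ≤ isProjective B,
    ClosedUnderDirectLimits (isProjective B)]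

/-! ## `Add(M)` and the monad of an object -/

section Monad

variable {A : Type u} [Category.{v} A] [HasColimits A]

/-- `Add(M)`: the class of direct summands of coproducts of copies of `M`. -/
def addClass (M : A) : ObjectProperty A := fun N =>
  ∃ (X : Type v) (N' : A), Nonempty ((N ⨿ N') ≅ ∐ fun _ : X => M)

/-- The monad `X ↦ Hom(M, M^(X))` on the category of sets, coming from the adjunction between
`X ↦ M^(X)` and `N ↦ Hom(M, N)`. -/
noncomputable def monadOf (M : A) : Monad (Type v) := (sigmaConstAdj M).toMonad

/-- The category `B` of modules (algebras) over the monad `monadOf M`. -/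
abbrev ModulesOver (M : A) : Type (v + 1) := (monadOf M).Algebra

/-- The free module with one generator over `monadOf M`; its underlying set is
`Hom(M, M^(*)) = Hom(M, M)`. -/
noncomputable def freeOne (M : A) : ModulesOver M := (monadOf M).free.obj PUnit.{v + 1}

end Monad

/-! ## The telescope Hom exactness condition -/

section Telescope

variable {A : Type u} [Category.{v} A] [Preadditive A] [HasColimits A]

/-- The inductive system `M ⟶ M ⟶ M ⟶ ⋯` with transition morphisms `f 0, f 1, f 2, …`. -/
def bassSystem (M : A) (f : ℕ → (M ⟶ M)) : ℕ ⥤ A :=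
  Functor.ofSequence (X := fun _ => M) f

/-- The endomorphism `id - shift` of the coproduct of countably many copies of `M`, where `shift`
maps the `n`-th summand to the `(n + 1)`-st one by `f n`. -/
noncomputable def telescopeMap (M : A) (f : ℕ → (M ⟶ M)) :
    (∐ fun _ : ℕ => M) ⟶ (∐ fun _ : ℕ => M) :=
  𝟙 _ - Limits.Sigma.desc fun n => f n ≫ Limits.Sigma.ι (fun _ : ℕ => M) (n + 1)

/-- The natural morphism from the coproduct of the copies of `M` to the direct limit. -/
noncomputable def telescopeProj (M : A) (f : ℕ → (M ⟶ M)) :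
    (∐ fun _ : ℕ => M) ⟶ colimit (bassSystem M f) :=
  Limits.Sigma.desc fun n => colimit.ι (bassSystem M f) n

/-- The telescope Hom exactness condition: for all sequences of endomorphisms of `M`,
`Hom(M, ∐ M) ⟶ Hom(M, ∐ M) ⟶ Hom(M, colim M) ⟶ 0` is exact. -/
def THEC (M : A) : Prop :=
  ∀ f : ℕ → (M ⟶ M),
    Function.Exact (fun g : M ⟶ (∐ fun _ : ℕ => M) => g ≫ telescopeMap M f)
      (fun g : M ⟶ (∐ fun _ : ℕ => M) => g ≫ telescopeProj M f) ∧
    Function.Surjective (fun g : M ⟶ (∐ fun _ : ℕ => M) => g ≫ telescopeProj M f)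

end Telescope

/-- A locally presentable category is cocomplete. -/
instance hasColimits_of_isLocallyPresentable {A : Type u} [Category.{v} A]
    [IsLocallyPresentable.{v} A] : HasColimits A := by
  obtain ⟨κ, _, _⟩ := IsLocallyPresentable.exists_cardinal.{v} A
  exact inferInstanceAs (HasColimitsOfSize.{v, v} A)

end EnochsAdd

open EnochsAdd

/-!
The functor `N ↦ Hom(M, N)` from `A` to the category `B` of modules over the monad of `M` (the
comparison functor of the adjunction between copowers of `M` and `Hom(M, -)`) sends the copower of
`M` with index set `X` to the free module on `X`. Hence it is bijective on morphisms out of a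
copower of `M`, and therefore out of any object of `Add(M)` (`homFunctor_map_bijective`). As
idempotents split in `A`, it identifies `Add(M)` with the class of projective modules
(`isProjective_homFunctor_obj`, `exists_homFunctor_obj_iso`). It follows formally that `D` has an
`Add(M)`-cover if and only if `Hom(M, D)` has a projective cover (`hasCover_addClass_iff`), and that
`Add(M)` is closed under direct limits if the projective modules are
(`closedUnderDirectLimits_addClass`).

The remaining link from `A` to `B` is the telescope condition. A countable direct limit of copies of
the free module on one generator is the colimit of a sequence of endomorphisms, all of which come
from endomorphisms of `M`; the telescope Hom exactness condition says that `Hom(M, -)` preserves the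
colimit of the corresponding sequence in `A` (`nonempty_isColimit_homFunctor_bassSystem`). So covers
of countable direct limits of copies of `M` yield projective covers of countable direct limits of
copies of the free module, and the assumed equivalences in `B` close the circle.

Two facts about `B` are needed. It is cocomplete, like the category of algebras over any monad on
types (`hasColimits_algebra`, by the general adjoint functor theorem). And free modules are
projective with respect to all epimorphisms, since epimorphisms of algebras over an additive monad
are surjective (`surjective_of_epi`): one divides the target by the image.
-/

/-! ### Quotient algebras and colimits of algebras over a monad on types -/

namespace CategoryTheory.Monad

section Quotient

variable {C : Type u} [Category.{v} C] {T : Monad C}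

/-- The algebra structure on a quotient `q : Y.A ⟶ Q` of the carrier of an algebra `Y`, for a
split epimorphism `q` whose kernel pair is compatible with the structure morphism of `Y`. The
compatibility is expressed with the help of the chosen section `s` of `q`. -/
@[simps]
def quotientAlgebra (Y : T.Algebra) {Q : C} (q : Y.A ⟶ Q) (s : Q ⟶ Y.A) (hs : s ≫ q = 𝟙 Q)
    (h : T.map q ≫ T.map s ≫ Y.a ≫ q = Y.a ≫ q) : T.Algebra where
  A := Q
  a := T.map s ≫ Y.a ≫ q
  unit := by
    have := T.η.naturality s
    dsimp at this
    rw [← reassoc_of% this, Y.unit_assoc, hs]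
  assoc := by
    have := T.μ.naturality s
    dsimp at this
    simp only [Functor.map_comp, Category.assoc, h]
    rw [← reassoc_of% this, Y.assoc_assoc]

/-- The projection of an algebra onto a quotient algebra. -/
@[simps]
def quotientAlgebraπ (Y : T.Algebra) {Q : C} (q : Y.A ⟶ Q) (s : Q ⟶ Y.A) (hs : s ≫ q = 𝟙 Q)
    (h : T.map q ≫ T.map s ≫ Y.a ≫ q = Y.a ≫ q) : Y ⟶ quotientAlgebra Y q s hs h where
  f := q
  h := h

end Quotient

section Types

variable (T : Monad (Type v))

/-- A homomorphism of algebras `h : X ⟶ Y` over a monad on types factors through an algebra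
structure on the quotient of `X` by the kernel of `h`. -/
lemma exists_algebra_quotient_ker {X Y : T.Algebra} (h : X ⟶ Y) :
    ∃ (Z : T.Algebra) (_ : Z.A = _root_.Quotient (Setoid.ker h.f)) (p : X ⟶ Z) (i : Z ⟶ Y),
      p ≫ i = h ∧ Function.Injective i.f := by
  let q : X.A ⟶ _root_.Quotient (Setoid.ker h.f) := ↾_root_.Quotient.mk _
  let s : _root_.Quotient (Setoid.ker h.f) ⟶ X.A := ↾_root_.Quotient.out
  let j : _root_.Quotient (Setoid.ker h.f) ⟶ Y.A := ↾_root_.Quotient.lift h.f fun _ _ w => w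
  have hs : s ≫ q = 𝟙 _ := by
    ext x
    exact _root_.Quotient.out_eq x
  have hqj : q ≫ j = h.f := rfl
  have hj : Function.Injective j := by
    intro x y
    induction x using Quotient.inductionOn
    induction y using Quotient.inductionOn
    exact fun w => _root_.Quotient.sound w
  have hmono : Mono j := (mono_iff_injective j).2 hj
  have hsj : s ≫ h.f = j :=
    calc s ≫ h.f = (s ≫ q) ≫ j := rfl
      _ = j := by rw [hs, Category.id_comp]
  have hh : T.map q ≫ T.map s ≫ X.a ≫ q = X.a ≫ q := by
    rw [← cancel_mono j]
    simp only [Category.assoc, hqj]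
    rw [← h.h, ← T.map_comp_assoc s, hsj, ← T.map_comp_assoc q, hqj]
  refine ⟨quotientAlgebra X q s hs hh, rfl, quotientAlgebraπ X q s hs hh,
    { f := j, h := ?_ }, ?_, hj⟩
  · change T.map j ≫ Y.a = (T.map s ≫ X.a ≫ q) ≫ j
    simp only [Category.assoc, hqj]
    rw [← h.h, ← T.map_comp_assoc s, hsj]
  · ext1
    exact hqj

/-- The category of algebras over a monad on types is cocomplete: by the general adjoint functor
theorem, as every cocone factors through the image of a free algebra on the disjoint union of the
objects of the diagram, and such images form a set up to isomorphism. -/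
instance hasColimits_algebra : HasColimits T.Algebra where
  has_colimits_of_shape J _ := by
    have : HasLimits T.Algebra :=
      ⟨fun _ _ => ⟨fun D => hasLimit_of_comp_forget_hasLimit D⟩⟩
    rw [hasColimitsOfShape_iff_isRightAdjoint_const]
    apply isRightAdjoint_of_preservesLimits_of_solutionSetCondition
    intro F
    let S : Type v := Σ j, (F.obj j).A
    let alg (r : Setoid (T.obj S)) (a : { a : T.obj (_root_.Quotient r) ⟶ _root_.Quotient r //
        T.η.app _ ≫ a = 𝟙 _ ∧ T.μ.app _ ≫ a = T.map a ≫ a }) : T.Algebra :=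
      { A := _root_.Quotient r, a := a.1, unit := a.2.1, assoc := a.2.2 }
    refine ⟨Σ (r : Setoid (T.obj S)) (a : { a : T.obj (_root_.Quotient r) ⟶ _root_.Quotient r //
        T.η.app _ ≫ a = 𝟙 _ ∧ T.μ.app _ ≫ a = T.map a ≫ a }),
      F ⟶ (Functor.const J).obj (alg r a), fun i => alg i.1 i.2.1, fun i => i.2.2, ?_⟩
    intro Y c
    let m : S ⟶ Y.A := ↾fun x => (c.app x.1).f x.2
    let h : T.free.obj S ⟶ Y := (T.adj.homEquiv S Y).symm m
    have hm : T.η.app S ≫ h.f = m := (T.adj.homEquiv S Y).apply_symm_apply m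
    obtain ⟨Z, e, p, i, hpi, hi⟩ := exists_algebra_quotient_ker T h
    have hiff : ∀ j (x : (F.obj j).A), i.f (p.f (T.η.app S ⟨j, x⟩)) = (c.app j).f x :=
      fun j x => by
        have := ConcreteCategory.congr_hom hm ⟨j, x⟩
        rw [← hpi] at this
        exact this
    have : Mono i := T.forget.mono_of_mono_map ((mono_iff_injective i.f).2 hi)
    -- the cocone `c` factors through the image `Z` of `h`
    let c' : F ⟶ (Functor.const J).obj Z :=
      { app j :=
          { f := ↾fun x => p.f (T.η.app S ⟨j, x⟩)
            h := by
              have : Mono i.f := (mono_iff_injective i.f).2 hi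
              have hji : (↾fun x => p.f (T.η.app S ⟨j, x⟩)) ≫ i.f = (c.app j).f := by
                ext x
                exact hiff j x
              rw [← cancel_mono i.f, Category.assoc, Category.assoc]
              dsimp only [Functor.const_obj_obj]
              rw [hji, ← i.h, ← T.map_comp_assoc, hji]
              exact (c.app j).h }
        naturality j k φ := by
          rw [← cancel_mono i]
          ext x
          refine (hiff k _).trans (Eq.trans ?_ (hiff j x).symm)
          exact ConcreteCategory.congr_hom (congrArg Algebra.Hom.f (c.naturality φ)) x }
    obtain ⟨A, a, hu, ha⟩ := Z
    obtain rfl : A = _ := e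
    refine ⟨⟨_, ⟨a, hu, ha⟩, c'⟩, i, ?_⟩
    ext j x
    exact hiff j x

end Types

end CategoryTheory.Monad

/-! ### Additive monads on types -/

namespace CategoryTheory.Monad

section Elements

variable {T : Monad (Type v)}

lemma map_η_apply {X Y : Type v} (f : X ⟶ Y) (x : X) :
    T.map f (T.η.app X x) = T.η.app Y (f x) :=
  (ConcreteCategory.congr_hom (T.η.naturality f) x).symm

lemma μ_η_apply {X : Type v} (t : T.obj X) : T.μ.app X (T.η.app (T.obj X) t) = t :=
  ConcreteCategory.congr_hom (T.left_unit X) t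

lemma map_comp_apply' {X Y Z : Type v} (f : X ⟶ Y) (g : Y ⟶ Z) (t : T.obj X) :
    T.map g (T.map f t) = T.map (f ≫ g) t :=
  (ConcreteCategory.congr_hom (T.map_comp f g) t).symm

lemma Algebra.a_η_apply (Y : T.Algebra) (y : Y.A) : Y.a (T.η.app Y.A y) = y :=
  ConcreteCategory.congr_hom Y.unit y

lemma Algebra.a_surjective (Y : T.Algebra) : Function.Surjective Y.a :=
  fun y => ⟨_, a_η_apply Y y⟩

lemma Algebra.a_μ_apply (Y : T.Algebra) (t : T.obj (T.obj Y.A)) :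
    Y.a (T.μ.app Y.A t) = Y.a (T.map Y.a t) :=
  ConcreteCategory.congr_hom Y.assoc t

lemma Algebra.hom_a_apply {X Y : T.Algebra} (f : X ⟶ Y) (t : T.obj X.A) :
    f.f (X.a t) = Y.a (T.map f.f t) :=
  (ConcreteCategory.congr_hom f.h t).symm

end Elements

/-- A monad on types with values in abelian groups is additive if the functorial maps and the
multiplication are additive, and the difference of two functorial maps is given by substitution of
the differences of generators. -/
class IsAdditive (T : Monad (Type v)) [∀ X : Type v, AddCommGroup (T.obj X)] : Prop where
  map_sub {X Y : Type v} (f : X ⟶ Y) (t t' : T.obj X) : T.map f (t - t') = T.map f t - T.map f t'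
  μ_sub {X : Type v} (t t' : T.obj (T.obj X)) :
    T.μ.app X (t - t') = T.μ.app X t - T.μ.app X t'
  map_sub_map {X Y : Type v} (f g : X ⟶ Y) (t : T.obj X) :
    T.map f t - T.map g t =
      T.μ.app Y (T.map (↾fun x => T.η.app Y (f x) - T.η.app Y (g x)) t)

namespace Algebra

variable {T : Monad (Type v)} [∀ X : Type v, AddCommGroup (T.obj X)] (Y : T.Algebra)

/-- The subtraction on the carrier of an algebra over an additive monad, induced by that of the free
algebras. -/
noncomputable def sub (y z : Y.A) : Y.A :=
  Y.a (T.η.app Y.A y - T.η.app Y.A z)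

lemma sub_self (y z : Y.A) : sub Y y y = sub Y z z := by
  simp [sub]

variable [IsAdditive T]

lemma a_sub (t t' : T.obj Y.A) : Y.a (t - t') = sub Y (Y.a t) (Y.a t') := by
  have := a_μ_apply Y (T.η.app (T.obj Y.A) t - T.η.app (T.obj Y.A) t')
  rwa [IsAdditive.μ_sub, IsAdditive.map_sub, map_η_apply, map_η_apply, μ_η_apply,
    μ_η_apply] at this

lemma hom_sub {X Y : T.Algebra} (f : X ⟶ Y) (y z : X.A) :
    f.f (sub X y z) = sub Y (f.f y) (f.f z) := by
  simp only [sub, hom_a_apply, IsAdditive.map_sub, map_η_apply]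

/-- The structure map of an algebra is additive in the substituted elements. -/
lemma sub_a_map {X : Type v} (f g : X ⟶ Y.A) (t : T.obj X) :
    sub Y (Y.a (T.map f t)) (Y.a (T.map g t)) = Y.a (T.map (↾fun x => sub Y (f x) (g x)) t) := by
  rw [← a_sub, IsAdditive.map_sub_map, a_μ_apply, map_comp_apply']
  rfl

lemma sub_sub_self (y : Y.A) : sub Y y (sub Y y y) = y := by
  obtain ⟨y, rfl⟩ := a_surjective Y y
  simp [← a_sub]

lemma zero_sub_sub (y z w : Y.A) : sub Y (sub Y w w) (sub Y y z) = sub Y z y := by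
  obtain ⟨y, rfl⟩ := a_surjective Y y
  obtain ⟨z, rfl⟩ := a_surjective Y z
  obtain ⟨w, rfl⟩ := a_surjective Y w
  simp [← a_sub]

lemma sub_sub_sub (x y z : Y.A) : sub Y (sub Y x y) (sub Y z y) = sub Y x z := by
  obtain ⟨x, rfl⟩ := a_surjective Y x
  obtain ⟨y, rfl⟩ := a_surjective Y y
  obtain ⟨z, rfl⟩ := a_surjective Y z
  simp [← a_sub]

lemma eq_of_sub_eq_sub_self {y z w : Y.A} (h : sub Y y z = sub Y w w) : y = z := by
  rw [← sub_sub_self Y y, ← sub_sub_sub Y y z, h, sub_self Y y w, zero_sub_sub,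
    sub_self Y w z, sub_sub_self]

/-- The congruence on an algebra that corresponds to the image of a homomorphism: two elements are
congruent if their difference lies in the image. -/
def congruence {X Y : T.Algebra} (e : X ⟶ Y) : Setoid Y.A where
  r y z := ∃ x, e.f x = sub Y y z
  iseqv :=
    { refl y := by
        let x := X.a 0
        exact ⟨sub X x x, by rw [hom_sub, sub_self]⟩
      symm := by
        rintro y z ⟨x, hx⟩
        exact ⟨sub X (sub X x x) x, by rw [hom_sub, hom_sub, hx, zero_sub_sub]⟩
      trans := by
        rintro y z w ⟨x, hx⟩ ⟨x', hx'⟩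
        refine ⟨sub X x (sub X (sub X x x) x'), ?_⟩
        rw [hom_sub, hom_sub, hom_sub, hx, hx', zero_sub_sub, sub_sub_sub] }

/-- Epimorphisms of algebras over an additive monad are surjective: the projection onto the quotient
by the image of a homomorphism `e` and the zero homomorphism agree after composition with `e`. -/
lemma surjective_of_epi {X Y : T.Algebra} (e : X ⟶ Y) [Epi e] : Function.Surjective e.f := by
  let q : Y.A ⟶ _root_.Quotient (congruence e) := ↾_root_.Quotient.mk _
  let s : _root_.Quotient (congruence e) ⟶ Y.A := ↾_root_.Quotient.out
  have hq {y z : Y.A} : q y = q z ↔ ∃ x, e.f x = sub Y y z := _root_.Quotient.eq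
  have hs : s ≫ q = 𝟙 _ := by
    ext x
    exact Quotient.out_eq x
  -- every element differs from the chosen representative of its class by an element of the image
  have hk (y : Y.A) : ∃ x, e.f x = sub Y (s (q y)) y :=
    hq.1 (ConcreteCategory.congr_hom hs (q y))
  choose k hk using hk
  have hh : T.map q ≫ T.map s ≫ Y.a ≫ q = Y.a ≫ q := by
    ext t
    refine hq.2 ⟨X.a (T.map (↾k) t), ?_⟩
    have := sub_a_map Y (q ≫ s) (𝟙 Y.A) t
    rw [hom_a_apply, map_comp_apply']
    refine Eq.trans ?_ (Eq.trans this.symm ?_)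
    · congr 2
      congr 2
      ext y
      exact hk y
    · congr 2
      · exact congrArg Y.a (map_comp_apply' q s t).symm
      · exact congrArg Y.a (show T.map (𝟙 Y.A) t = t by simp)
  let Z := quotientAlgebra Y q s hs hh
  let p : Y ⟶ Z := quotientAlgebraπ Y q s hs hh
  let z : Y ⟶ Z :=
    { f := ↾fun y => sub Z (p.f y) (p.f y)
      h := by
        ext t
        refine (sub_a_map Z p.f p.f t).symm.trans ?_
        rw [← hom_a_apply]
        rfl }
  have hz (y : Y.A) : z.f y = q (sub Y y y) := (hom_sub p y y).symm
  have hpz : p = z := by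
    rw [← cancel_epi e]
    ext x
    refine Eq.trans ?_ (hz (e.f x)).symm
    exact hq.2 ⟨x, (sub_sub_self Y _).symm⟩
  intro y
  obtain ⟨x, hx⟩ := hq.1 (show q y = q (sub Y y y) from
    (congrArg (fun f : Y ⟶ Z => f.f y) hpz).trans (hz y))
  exact ⟨x, hx.trans (sub_sub_self Y y)⟩

/-- Free algebras over an additive monad are projective. -/
instance projective_free (X : Type v) : Projective (T.free.obj X) := by
  have : T.forget.PreservesEpimorphisms :=
    ⟨fun e _ => (epi_iff_surjective e.f).2 (surjective_of_epi e)⟩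
  have : Projective X := inferInstance
  exact T.adj.map_projective X inferInstance

end Algebra

end CategoryTheory.Monad

/-! ### The additive structure of the monad of an object -/

namespace EnochsAdd

variable {A : Type u} [Category.{v} A] [HasColimits A] (M : A)

/-- The functorial maps of the monad `monadOf M` in terms of the coproducts of copies of `M`. -/
lemma monadOf_map_apply {X Y : Type v} (f : X ⟶ Y) (t : (monadOf M).obj X) :
    (monadOf M).map f t = (show M ⟶ ∐ fun _ : X => M from t) ≫
      Sigma.desc fun x => Sigma.ι (fun _ : Y => M) (f x) := by
  change (show M ⟶ ∐ fun _ : X => M from t) ≫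
    Sigma.map' (g := fun _ : Y => M) f (fun _ => 𝟙 M) = _
  congr 1
  ext x
  simp

variable [Preadditive A]

/-- The group structure of the hom-groups of the preadditive category `A`. -/
noncomputable instance (X : Type v) : AddCommGroup ((monadOf M).obj X) :=
  inferInstanceAs (AddCommGroup (M ⟶ ∐ fun _ : X => M))

/-- The monad of an object of a preadditive category is additive, by biadditivity of composition. -/
instance : (monadOf M).IsAdditive where
  map_sub _ _ _ := Preadditive.sub_comp ..
  μ_sub _ _ := Preadditive.sub_comp ..
  map_sub_map {X Y} f g t := by
    rw [monadOf_map_apply, monadOf_map_apply, monadOf_map_apply]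
    refine (Preadditive.comp_sub ..).symm.trans (Eq.trans ?_ (Category.assoc _ _ _).symm)
    congr 1
    ext x
    change _ = Sigma.ι (fun _ : X => M) x ≫ Sigma.desc (fun x => Sigma.ι
      (fun _ : (M ⟶ ∐ fun _ : Y => M) => M)
        (Sigma.ι (fun _ : Y => M) (f x) - Sigma.ι (fun _ : Y => M) (g x))) ≫
      Sigma.desc (fun t : (M ⟶ ∐ fun _ : Y => M) => t)
    simp [Preadditive.comp_sub]

end EnochsAdd

/-! ### The equivalence between `Add(M)` and the projective modules -/

namespace CategoryTheory

variable {C : Type u} [Category.{v} C]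

/-- A retract in a preadditive category with coequalizers has a complement. -/
lemma Retract.exists_coprod_iso [Preadditive C] [HasCoequalizers C] [HasBinaryCoproducts C]
    {N X : C} (h : Retract N X) : ∃ N' : C, Nonempty ((N ⨿ N') ≅ X) := by
  -- the complement splits the idempotent `p`
  let p : X ⟶ X := 𝟙 X - h.r ≫ h.i
  have hp : p ≫ p = p := by simp [p]
  have hip : h.i ≫ p = 0 := by simp [p]
  have hpr : p ≫ h.r = 0 := by simp [p]
  let r' : X ⟶ coequalizer (𝟙 X) p := coequalizer.π _ _
  let i' : coequalizer (𝟙 X) p ⟶ X := coequalizer.desc p (by rw [hp, Category.id_comp])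
  have hri : r' ≫ i' = p := coequalizer.π_desc _ _
  have hpr' : p ≫ r' = r' := by rw [← coequalizer.condition, Category.id_comp]
  have hir : i' ≫ r' = 𝟙 _ := by
    rw [← cancel_epi r', reassoc_of% hri, hpr', Category.comp_id]
  have hi' : Mono i' := (IsSplitMono.mk' ⟨r', hir⟩).mono
  let b : BinaryBicone N (coequalizer (𝟙 X) p) :=
    { pt := X
      fst := h.r
      snd := r'
      inl := h.i
      inr := i'
      inl_fst := h.retract
      inr_snd := hir
      inl_snd := by rw [← cancel_mono i', Category.assoc, hri, hip, zero_comp]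
      inr_fst := by rw [← cancel_epi r', reassoc_of% hri, hpr, comp_zero] }
  have hb : b.IsBilimit := isBinaryBilimitOfTotal b (by
    change h.r ≫ h.i + r' ≫ i' = 𝟙 X
    simp [hri, p])
  exact ⟨_, ⟨(coprodIsCoprod N _).coconePointUniqueUpToIso hb.isColimit⟩⟩

/-- If `F.obj X` retracts onto `Q` and `F` is full and faithful on endomorphisms of `X`, then `Q` is
the image of a retract of `X`. -/
lemma Functor.exists_retract_of_retract_obj {D : Type*} [Category* D] [HasCoequalizers C]
    (F : C ⥤ D) {X : C} (hX : Function.Bijective (F.map : (X ⟶ X) → _)) {Q : D}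
    (h : Retract Q (F.obj X)) :
    ∃ N : C, Nonempty (Retract N X) ∧ Nonempty (F.obj N ≅ Q) := by
  obtain ⟨p, hp⟩ := hX.2 (h.r ≫ h.i)
  have hpp : p ≫ p = p := hX.1 (by simp [hp])
  let r : X ⟶ coequalizer (𝟙 X) p := coequalizer.π _ _
  let i : coequalizer (𝟙 X) p ⟶ X := coequalizer.desc p (by rw [hpp, Category.id_comp])
  have hri : r ≫ i = p := coequalizer.π_desc _ _
  have hpr : p ≫ r = r := by rw [← coequalizer.condition, Category.id_comp]
  have hir : i ≫ r = 𝟙 _ := by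
    rw [← cancel_epi r, reassoc_of% hri, hpr, Category.comp_id]
  refine ⟨_, ⟨⟨i, r, hir⟩⟩, ⟨⟨F.map i ≫ h.r, h.i ≫ F.map r, ?_, ?_⟩⟩⟩
  · rw [Category.assoc, ← Category.assoc h.r, ← hp, ← F.map_comp, ← F.map_comp, hpr, hir, F.map_id]
  · rw [Category.assoc, ← F.map_comp_assoc, hri, hp, Category.assoc, h.retract, Category.comp_id,
      h.retract]

end CategoryTheory

namespace EnochsAdd

variable {A : Type u} [Category.{v} A] [HasColimits A] (M : A)

/-- The functor `N ↦ Hom(M, N)` with values in the category of modules over `monadOf M`. -/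
noncomputable abbrev homFunctor : A ⥤ ModulesOver M := Monad.comparison (sigmaConstAdj M)

/-- As `Hom(M, -)` sends a copower of `M` to a free module, morphisms out of either are families of
elements of `Hom(M, D)`. -/
lemma homFunctor_map_bijective_coproduct (X : Type v) (D : A) : Function.Bijective
    ((homFunctor M).map : ((∐ fun _ : X => M) ⟶ D) → _) := by
  let e : ((homFunctor M).obj (∐ fun _ : X => M) ⟶ (homFunctor M).obj D) ≃ _ :=
    (monadOf M).adj.homEquiv X ((homFunctor M).obj D)
  rw [← e.bijective.of_comp_iff']
  exact ((sigmaConstAdj M).homEquiv X D).bijective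

variable {M}

/-- Hom functors are fully faithful on morphisms from retracts of coproducts of copies of `M`. -/
lemma homFunctor_map_bijective_of_retract {N : A} {X : Type v}
    (h : Retract N (∐ fun _ : X => M)) (D : A) :
    Function.Bijective ((homFunctor M).map : (N ⟶ D) → _) := by
  have hX := homFunctor_map_bijective_coproduct M X D
  refine ⟨fun f g hfg => ?_, fun φ => ?_⟩
  · have := hX.1 (a₁ := h.r ≫ f) (a₂ := h.r ≫ g) (by simp only [Functor.map_comp, hfg])
    simpa using congrArg (h.i ≫ ·) this
  · obtain ⟨f, hf⟩ := hX.2 ((homFunctor M).map h.r ≫ φ)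
    refine ⟨h.i ≫ f, ?_⟩
    rw [Functor.map_comp, hf, ← Functor.map_comp_assoc, h.retract,
      CategoryTheory.Functor.map_id, Category.id_comp]

variable [Preadditive A]

lemma addClass_iff_retract {N : A} :
    addClass M N ↔ ∃ X : Type v, Nonempty (Retract N (∐ fun _ : X => M)) := by
  constructor
  · rintro ⟨X, N', ⟨e⟩⟩
    exact ⟨X, ⟨⟨coprod.inl ≫ e.hom, e.inv ≫ coprod.desc (𝟙 N) 0, by
      rw [Category.assoc, e.hom_inv_id_assoc, coprod.inl_desc]⟩⟩⟩
  · rintro ⟨X, ⟨h⟩⟩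
    obtain ⟨N', e⟩ := h.exists_coprod_iso
    exact ⟨X, N', e⟩

lemma homFunctor_map_bijective {N : A} (hN : addClass M N) (D : A) :
    Function.Bijective ((homFunctor M).map : (N ⟶ D) → _) := by
  obtain ⟨X, ⟨h⟩⟩ := addClass_iff_retract.1 hN
  exact homFunctor_map_bijective_of_retract h D

lemma isProjective_homFunctor_obj {N : A} (hN : addClass M N) :
    isProjective (ModulesOver M) ((homFunctor M).obj N) := by
  obtain ⟨X, ⟨h⟩⟩ := addClass_iff_retract.1 hN
  have : Projective ((homFunctor M).obj (∐ fun _ : X => M)) :=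
    inferInstanceAs (Projective ((monadOf M).free.obj X))
  exact (h.map (homFunctor M)).projective

/-- Every projective module is of the form `Hom(M, N)` with `N` in `Add(M)`: it is a retract of a
free module, and the corresponding idempotent comes from a copower of `M`, where it splits. -/
lemma exists_homFunctor_obj_iso {Q : ModulesOver M} (hQ : isProjective (ModulesOver M) Q) :
    ∃ N : A, addClass M N ∧ Nonempty ((homFunctor M).obj N ≅ Q) := by
  have : Projective Q := hQ
  let c : (monadOf M).free.obj Q.A ⟶ Q := { f := Q.a, h := Q.assoc.symm }
  have hc : Epi c := by
    have : Epi c.f := (epi_iff_surjective Q.a).2 Q.a_surjective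
    exact (monadOf M).algebra_epi_of_epi c
  obtain ⟨s, hs⟩ := Projective.factors (𝟙 Q) c
  have h : Retract Q ((homFunctor M).obj (∐ fun _ : Q.A => M)) :=
    ⟨s, c, hs⟩
  obtain ⟨N, ⟨hN⟩, e⟩ := (homFunctor M).exists_retract_of_retract_obj
    (homFunctor_map_bijective_coproduct M _ _) h
  exact ⟨N, addClass_iff_retract.2 ⟨_, ⟨hN⟩⟩, e⟩

lemma addClass_of_iso {N N' : A} (e : N ≅ N') (hN : addClass M N) : addClass M N' := by
  obtain ⟨X, ⟨h⟩⟩ := addClass_iff_retract.1 hN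
  exact addClass_iff_retract.2 ⟨X, ⟨(Retract.ofIso e.symm).trans h⟩⟩

lemma copies_le_addClass : copies M ≤ addClass M := by
  rintro N ⟨e⟩
  refine addClass_iff_retract.2 ⟨PUnit, ⟨(Retract.ofIso e).trans
    ⟨Sigma.ι (fun _ : PUnit => M) ⟨⟩, Sigma.desc fun _ => 𝟙 M, by simp⟩⟩⟩

/-! ### Covers -/

lemma hasCover_of_iso {C : Type u} [Category.{v} C] (L : ObjectProperty C) {Y Y' : C} (e : Y ≅ Y')
    (h : hasCover L Y) : hasCover L Y' := by
  obtain ⟨X, l, hl⟩ := h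
  refine ⟨X, l ≫ e.hom, ⟨hl.mem, fun X' l' hX' => ?_⟩, fun f hf => hl.isIso f ?_⟩
  · obtain ⟨f, hf⟩ := hl.factors X' (l' ≫ e.inv) hX'
    exact ⟨f, by rw [reassoc_of% hf, e.inv_hom_id, Category.comp_id]⟩
  · rwa [← cancel_mono e.hom, Category.assoc]

lemma le_hasCover {C : Type u} [Category.{v} C] (L : ObjectProperty C) : L ≤ hasCover L := by
  intro X hX
  refine ⟨X, 𝟙 X, ⟨hX, fun X' l' _ => ⟨l', Category.comp_id l'⟩⟩, fun e he => ?_⟩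
  obtain rfl : e = 𝟙 X := by rw [← he, Category.comp_id]
  infer_instance

/-- An object `D` has an `Add(M)`-cover if and only if the module `Hom(M, D)` has a projective
cover. -/
lemma hasCover_addClass_iff (D : A) : hasCover (addClass M) D ↔
    hasCover (isProjective (ModulesOver M)) ((homFunctor M).obj D) := by
  constructor
  · rintro ⟨L, l, hl⟩
    have hL := homFunctor_map_bijective hl.mem
    refine ⟨_, (homFunctor M).map l, ⟨isProjective_homFunctor_obj hl.mem, fun Q q hQ => ?_⟩,
      fun e he => ?_⟩
    · obtain ⟨N, hN, ⟨i⟩⟩ := exists_homFunctor_obj_iso hQ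
      obtain ⟨q', hq'⟩ := (homFunctor_map_bijective hN D).2 (i.hom ≫ q)
      obtain ⟨f, rfl⟩ := hl.factors N q' hN
      exact ⟨i.inv ≫ (homFunctor M).map f, by
        rw [Category.assoc, ← Functor.map_comp, hq', i.inv_hom_id_assoc]⟩
    · obtain ⟨e, rfl⟩ := (hL L).2 e
      have := hl.isIso e ((hL D).1 (by rw [Functor.map_comp, he]))
      infer_instance
  · rintro ⟨Q, q, hq⟩
    obtain ⟨L, hL, ⟨i⟩⟩ := exists_homFunctor_obj_iso hq.mem
    obtain ⟨l, hl⟩ := (homFunctor_map_bijective hL D).2 (i.hom ≫ q)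
    refine ⟨L, l, ⟨hL, fun N n hN => ?_⟩, fun e he => ?_⟩
    · obtain ⟨f, hf⟩ := hq.factors _ ((homFunctor M).map n) (isProjective_homFunctor_obj hN)
      obtain ⟨g, hg⟩ := (homFunctor_map_bijective hN L).2 (f ≫ i.inv)
      refine ⟨g, (homFunctor_map_bijective hN D).1 ?_⟩
      rw [Functor.map_comp, hg, hl, Category.assoc, i.inv_hom_id_assoc, hf]
    · have h := hq.isIso (i.inv ≫ (homFunctor M).map e ≫ i.hom) (by
        rw [Category.assoc, Category.assoc, ← hl, ← Functor.map_comp, he, hl,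
          i.inv_hom_id_assoc])
      have he' : IsIso ((homFunctor M).map e) := by
        have : (homFunctor M).map e =
            i.hom ≫ (i.inv ≫ (homFunctor M).map e ≫ i.hom) ≫ i.inv := by simp
        rw [this]
        infer_instance
      obtain ⟨g, hg⟩ := (homFunctor_map_bijective hL L).2 (inv ((homFunctor M).map e))
      exact ⟨g, (homFunctor_map_bijective hL L).1 (by simp [hg]),
        (homFunctor_map_bijective hL L).1 (by simp [hg])⟩

/-! ### Direct limits -/

/-- A direct limit in `A` of objects of `Add(M)` belongs to `Add(M)` as soon as the direct limit of
the corresponding projective modules is projective: a projective module `Hom(M, N)` with `N` in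
`Add(M)` which is the colimit of the modules `Hom(M, N_i)` forces `N` to be the colimit of the
`N_i`. -/
lemma closedUnderDirectLimits_addClass
    (h : ClosedUnderDirectLimits (isProjective (ModulesOver M))) :
    ClosedUnderDirectLimits (addClass M) := by
  rintro D ⟨Θ, _, _, _, ⟨p⟩⟩
  let F := p.diag ⋙ homFunctor M
  obtain ⟨N, hN, ⟨i⟩⟩ := exists_homFunctor_obj_iso (h (colimit F) ⟨Θ, _, ‹_›, ‹_›,
    ⟨.colimit F fun j => isProjective_homFunctor_obj (p.prop_diag_obj j)⟩⟩)
  have hF (j : Θ) := homFunctor_map_bijective (p.prop_diag_obj j)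
  choose n hn using fun j => (hF j N).2 (colimit.ι F j ≫ i.inv)
  let c : Cocone p.diag :=
    { pt := N
      ι :=
        { app := n
          naturality j k φ := (hF j N).1 (by
            have : (homFunctor M).map (p.diag.map φ) ≫ colimit.ι F k = colimit.ι F j :=
              colimit.w F φ
            simp [hn, reassoc_of% this]) } }
  have hex (s : Cocone p.diag) : ∃ f : N ⟶ s.pt, ∀ j, n j ≫ f = s.ι.app j := by
    obtain ⟨f, hf⟩ := (homFunctor_map_bijective hN s.pt).2
      (i.hom ≫ colimit.desc F ((homFunctor M).mapCocone s))
    refine ⟨f, fun j => (hF j _).1 ?_⟩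
    rw [Functor.map_comp, hf, hn]
    simp
  choose f hf using hex
  have hc : IsColimit c :=
    { desc := f
      fac := hf
      uniq s m hm := (homFunctor_map_bijective hN s.pt).1 (by
        rw [← cancel_epi i.inv]
        refine colimit.hom_ext fun j => ?_
        rw [← reassoc_of% hn j, ← reassoc_of% hn j, ← Functor.map_comp, ← Functor.map_comp, hf,
          ← hm]) }
  exact addClass_of_iso (hc.coconePointUniqueUpToIso p.isColimit) hN

end EnochsAdd

/-! ### Telescopes -/

namespace CategoryTheory.Monad.Algebra

variable {T : Monad (Type v)}

/-- A homomorphism of algebras that is constant on the fibres of a surjective homomorphism `p`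
factors through `p`. -/
lemma exists_factor_of_surjective {X Y Z : T.Algebra} (p : X ⟶ Z) (hp : Function.Surjective p.f)
    (φ : X ⟶ Y) (h : ∀ x x', p.f x = p.f x' → φ.f x = φ.f x') : ∃ ψ : Z ⟶ Y, p ≫ ψ = φ := by
  choose s hs using hp
  let g : Z.A ⟶ Y.A := ↾fun z => φ.f (s z)
  have hg : p.f ≫ g = φ.f := by
    ext x
    exact h _ _ (hs _)
  have hsp : ↾s ≫ p.f = 𝟙 Z.A := by
    ext z
    exact hs z
  have : IsSplitEpi (T.map p.f) := ⟨⟨T.map (↾s), by rw [← T.map_comp, hsp, T.map_id]⟩⟩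
  refine ⟨{ f := g, h := ?_ }, by ext1; exact hg⟩
  rw [← cancel_epi (T.map p.f), ← T.map_comp_assoc, hg, φ.h, p.h_assoc, hg]

end CategoryTheory.Monad.Algebra

namespace EnochsAdd

open Monad

variable {A : Type u} [Category.{v} A] [HasColimits A]

section

variable (M : A)

/-- The free module with one generator is the module `Hom(M, M)`. -/
noncomputable def freeOneIso : freeOne M ≅ (homFunctor M).obj M :=
  (homFunctor M).mapIso (X := ∐ fun _ : PUnit.{v + 1} => M)
    ⟨Sigma.desc fun _ => 𝟙 M, Sigma.ι (fun _ : PUnit.{v + 1} => M) ⟨⟩, by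
      refine Sigma.hom_ext _ _ fun _ => ?_
      rw [Sigma.ι_desc_assoc, Category.id_comp, Category.comp_id], by
      rw [Sigma.ι_desc]⟩

variable {M}

/-- The module `Hom(M, M)` is freely generated by the identity. -/
lemma homFunctor_obj_self_hom_ext {Y : ModulesOver M} {φ ψ : (homFunctor M).obj M ⟶ Y}
    (h : φ.f (𝟙 M) = ψ.f (𝟙 M)) : φ = ψ := by
  rw [← cancel_epi (freeOneIso M).hom]
  apply ((monadOf M).adj.homEquiv _ _).injective
  ext x
  have hx : (freeOneIso M).hom.f ((monadOf M).η.app _ x) = 𝟙 M :=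
    Sigma.ι_desc (f := fun _ : PUnit.{v + 1} => M) (fun _ => 𝟙 M) x
  change φ.f ((freeOneIso M).hom.f _) = ψ.f ((freeOneIso M).hom.f _)
  exact (congrArg φ.f hx).trans (h.trans (congrArg ψ.f hx).symm)

variable (M)

lemma homFunctor_copower_hom_ext {S : Type v} {Y : ModulesOver M}
    {φ ψ : (homFunctor M).obj (∐ fun _ : S => M) ⟶ Y}
    (h : ∀ s, (homFunctor M).map (Sigma.ι (fun _ : S => M) s) ≫ φ =
      (homFunctor M).map (Sigma.ι (fun _ : S => M) s) ≫ ψ) : φ = ψ := by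
  apply ((monadOf M).adj.homEquiv S Y).injective
  ext s
  have := congrArg (fun α : (homFunctor M).obj M ⟶ Y => α.f (𝟙 M)) (h s)
  have hs : ((homFunctor M).map (Sigma.ι (fun _ : S => M) s)).f (𝟙 M) =
    (monadOf M).η.app S s := Category.id_comp _
  refine (congrArg φ.f hs).symm.trans (Eq.trans ?_ (congrArg ψ.f hs))
  exact this

lemma homFunctor_copower_exists_desc {S : Type v} {Y : ModulesOver M}
    (y : S → ((homFunctor M).obj M ⟶ Y)) : ∃ φ : (homFunctor M).obj (∐ fun _ : S => M) ⟶ Y,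
      ∀ s, (homFunctor M).map (Sigma.ι (fun _ : S => M) s) ≫ φ = y s := by
  let m : S ⟶ Y.A := ↾fun s => (y s).f (𝟙 M)
  refine ⟨((monadOf M).adj.homEquiv S Y).symm m, fun s => homFunctor_obj_self_hom_ext ?_⟩
  have hs : ((homFunctor M).map (Sigma.ι (fun _ : S => M) s)).f (𝟙 M) =
    (monadOf M).η.app S s := Category.id_comp _
  refine (congrArg (((monadOf M).adj.homEquiv S Y).symm m).f hs).trans ?_
  exact ConcreteCategory.congr_hom (((monadOf M).adj.homEquiv S Y).apply_symm_apply m) s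

/-- The functor `Hom(M, -)` preserves copowers of `M` indexed by small sets of any universe. -/
lemma nonempty_isColimit_homFunctor_copower {S : Type*} [Small.{v} S]
    [HasCoproduct fun _ : S => M] :
    Nonempty (IsColimit (Cofan.mk ((homFunctor M).obj (∐ fun _ : S => M))
      fun s => (homFunctor M).map (Sigma.ι (fun _ : S => M) s))) := by
  have : HasCoproduct ((fun _ : Shrink.{v} S => M) ∘ equivShrink S) :=
    inferInstanceAs (HasCoproduct fun _ : S => M)
  let e : (∐ fun _ : S => M) ≅ (∐ fun _ : Shrink.{v} S => M) :=
    Sigma.reindex (equivShrink S) fun _ => M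
  have he (s : S) : Sigma.ι (fun _ : S => M) s ≫ e.hom =
      Sigma.ι (fun _ : Shrink.{v} S => M) (equivShrink S s) :=
    Sigma.ι_reindex_hom (equivShrink S) (fun _ => M) s
  have he' (s : S) : Sigma.ι (fun _ : Shrink.{v} S => M) (equivShrink S s) ≫ e.inv =
      Sigma.ι (fun _ : S => M) s := by rw [← he, Category.assoc, e.hom_inv_id, Category.comp_id]
  choose d hd using fun (Y : ModulesOver M) (y : S → ((homFunctor M).obj M ⟶ Y)) =>
    homFunctor_copower_exists_desc M fun s => y ((equivShrink S).symm s)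
  refine ⟨Cofan.IsColimit.mk _ (fun c => (homFunctor M).map e.hom ≫ d c.pt c.inj)
    (fun c s => ?_) (fun c m hm => ?_)⟩
  · have := hd c.pt c.inj (equivShrink S s)
    rw [Equiv.symm_apply_apply, ← he, Functor.map_comp, Category.assoc] at this
    exact this
  · rw [← cancel_epi ((homFunctor M).map e.inv)]
    refine homFunctor_copower_hom_ext M fun s => ?_
    obtain ⟨s, rfl⟩ := (equivShrink S).surjective s
    rw [← (homFunctor M).map_comp_assoc e.inv, e.inv_hom_id, CategoryTheory.Functor.map_id,
      Category.id_comp, hd, ← (homFunctor M).map_comp_assoc, he', Equiv.symm_apply_apply]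
    exact hm s

end

lemma bassSystem_map_succ {C : Type u} [Category.{v} C] {X : C} (f : ℕ → (X ⟶ X)) (n : ℕ) :
    (bassSystem X f).map (homOfLE (Nat.le_add_right n 1)) = f n :=
  Functor.ofSequence_map_homOfLE_succ f n

variable [Preadditive A] {M : A}

/-- On the modules `Hom(M, X)`, the subtraction of algebras over an additive monad is that of
`A`. -/
lemma sub_homFunctor_obj {X : A} (g g' : M ⟶ X) :
    Algebra.sub ((homFunctor M).obj X) g g' = g - g' := by
  refine (Preadditive.sub_comp ..).trans ?_
  congr 1
  · exact Sigma.ι_desc (f := fun _ : (M ⟶ X) => M) (fun x => x) g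
  · exact Sigma.ι_desc (f := fun _ : (M ⟶ X) => M) (fun x => x) g'

lemma homFunctor_obj_hom_sub {X : A} {Y : ModulesOver M} (φ : (homFunctor M).obj X ⟶ Y)
    (g g' : M ⟶ X) : φ.f (g - g') = Algebra.sub Y (φ.f g) (φ.f g') :=
  (congrArg φ.f (sub_homFunctor_obj g g').symm).trans (Algebra.hom_sub φ g g')

/-- Under the telescope Hom exactness condition, the functor `Hom(M, -)` preserves the direct limits
of sequences of endomorphisms of `M`, as both `Hom(M, colim M)` and the colimit of the modules
`Hom(M, M)` are cokernels of the same telescope map. -/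
lemma nonempty_isColimit_homFunctor_bassSystem (hM : THEC M) (f : ℕ → (M ⟶ M)) :
    Nonempty (IsColimit ((homFunctor M).mapCocone (colimit.cocone (bassSystem M f)))) := by
  obtain ⟨hc⟩ := nonempty_isColimit_homFunctor_copower M (S := ℕ)
  obtain ⟨hex, hsurj⟩ := hM f
  let p := (homFunctor M).map (telescopeProj M f)
  have hp : Function.Surjective p.f := hsurj
  have hpepi : Epi p := by
    have : Epi p.f := (epi_iff_surjective p.f).2 hp
    exact (monadOf M).algebra_epi_of_epi p
  -- the coprojections of the colimit and their lifts, as morphisms from `M` itself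
  let j (n : ℕ) : M ⟶ colimit (bassSystem M f) := colimit.ι (bassSystem M f) n
  let i (n : ℕ) : M ⟶ ∐ fun _ : ℕ => M := Sigma.ι (fun _ : ℕ => M) n
  have hip (n : ℕ) : (homFunctor M).map (i n) ≫ p = (homFunctor M).map (j n) := by
    rw [← Functor.map_comp]
    exact congrArg _ (Sigma.ι_desc _ _)
  have hext {Y : ModulesOver M} {φ ψ : (homFunctor M).obj (∐ fun _ : ℕ => M) ⟶ Y}
      (h : ∀ n, (homFunctor M).map (i n) ≫ φ = (homFunctor M).map (i n) ≫ ψ) : φ = ψ :=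
    Cofan.IsColimit.hom_ext hc _ _ h
  let shift : (∐ fun _ : ℕ => M) ⟶ (∐ fun _ : ℕ => M) := Sigma.desc fun n => f n ≫ i (n + 1)
  have hishift (n : ℕ) : i n ≫ shift = f n ≫ i (n + 1) := Sigma.ι_desc _ _
  have key {Y : ModulesOver M} (y : ℕ → ((homFunctor M).obj M ⟶ Y))
      (hy : ∀ n, (homFunctor M).map (f n) ≫ y (n + 1) = y n) :
      ∃ ψ : (homFunctor M).obj (colimit (bassSystem M f)) ⟶ Y,
        ∀ n, (homFunctor M).map (j n) ≫ ψ = y n := by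
    let φ : (homFunctor M).obj (∐ fun _ : ℕ => M) ⟶ Y := Cofan.IsColimit.desc hc y
    have hφ (n : ℕ) : (homFunctor M).map (i n) ≫ φ = y n := Cofan.IsColimit.fac hc _ n
    -- compatibility of the cocone means that `φ` does not see the shift
    have hshift : (homFunctor M).map shift ≫ φ = φ := by
      refine hext fun n => ?_
      rw [← Functor.map_comp_assoc, hishift, Functor.map_comp_assoc, hφ, hφ, hy]
    obtain ⟨ψ, hψ⟩ := Algebra.exists_factor_of_surjective p hp φ fun g g' hg => by
      -- `g - g'` is killed by the projection, hence comes from some `k` via the telescope map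
      let g₁ : M ⟶ ∐ fun _ : ℕ => M := g
      let g₂ : M ⟶ ∐ fun _ : ℕ => M := g'
      have hg' : g₁ ≫ telescopeProj M f = g₂ ≫ telescopeProj M f := hg
      obtain ⟨k, hk⟩ := (hex (g₁ - g₂)).1 (by
        dsimp only
        rw [Preadditive.sub_comp, hg', sub_self])
      have hk' : g₁ - g₂ = k - k ≫ shift := by
        rw [← hk]
        exact (Preadditive.comp_sub ..).trans (by rw [Category.comp_id])
      have h₁ : Algebra.sub Y (φ.f g₁) (φ.f g₂) =
          Algebra.sub Y (φ.f k) (φ.f (k ≫ shift)) := by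
        rw [← homFunctor_obj_hom_sub, ← homFunctor_obj_hom_sub, hk']
      have h₂ : φ.f (k ≫ shift) = φ.f k :=
        congrArg (fun α : (homFunctor M).obj (∐ fun _ : ℕ => M) ⟶ Y => α.f k) hshift
      rw [h₂] at h₁
      exact Monad.Algebra.eq_of_sub_eq_sub_self Y h₁
    exact ⟨ψ, fun n => by rw [← hip, Category.assoc, hψ, hφ]⟩
  choose d hd using fun s : Cocone (bassSystem M f ⋙ homFunctor M) =>
    key (fun n => s.ι.app n) fun n => by
      have := s.w (homOfLE (Nat.le_add_right n 1))
      change (homFunctor M).map ((bassSystem M f).map _) ≫ _ = _ at this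
      rwa [bassSystem_map_succ] at this
  refine ⟨⟨d, hd, fun s m hm => ?_⟩⟩
  rw [← cancel_epi p]
  refine hext fun n => ?_
  rw [reassoc_of% hip, reassoc_of% hip, hd]
  exact hm n

/-- Under the telescope Hom exactness condition, every countable direct limit of copies of the free
module with one generator is of the form `Hom(M, D)` for a countable direct limit `D` of copies
of `M`. -/
lemma exists_iso_of_countableDirectLimits (hM : THEC M) {Y : ModulesOver M}
    (hY : countableDirectLimits (copies (freeOne M)) Y) :
    ∃ D : A, countableDirectLimits (copies M) D ∧ Nonempty ((homFunctor M).obj D ≅ Y) := by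
  obtain ⟨Θ, _, _, _, _, ⟨p⟩⟩ := hY
  obtain ⟨x, hx, hx'⟩ := Filter.exists_seq_monotone_tendsto_atTop_atTop Θ
  have : hx.functor.Final := hx.final_functor_iff.2 fun j =>
    ((Filter.tendsto_atTop.1 hx' j).exists)
  let q := p.reindex hx.functor
  let e (n : ℕ) : q.diag.obj n ≅ (homFunctor M).obj M :=
    (q.prop_diag_obj n).some ≪≫ freeOneIso M
  choose f hf using fun n : ℕ => (homFunctor_map_bijective
    (copies_le_addClass M ⟨Iso.refl M⟩) M).2
    ((e n).inv ≫ q.diag.map (homOfLE (Nat.le_add_right n 1)) ≫ (e (n + 1)).hom)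
  let t : q.diag ⟶ bassSystem M f ⋙ homFunctor M := NatTrans.ofSequence (fun n => (e n).hom) (by
    intro n
    change _ = (e n).hom ≫ (homFunctor M).map ((bassSystem M f).map _)
    refine Eq.trans ?_ (congrArg (fun α : M ⟶ M => (e n).hom ≫ (homFunctor M).map α)
      (bassSystem_map_succ f n).symm)
    rw [hf, Iso.hom_inv_id_assoc]
    rfl)
  have ht : IsIso t := by
    have (n : ℕ) : IsIso (t.app n) := inferInstanceAs (IsIso (e n).hom)
    exact NatIso.isIso_of_isIso_app t
  obtain ⟨hc⟩ := nonempty_isColimit_homFunctor_bassSystem hM f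
  refine ⟨colimit (bassSystem M f), ⟨ULift ℕ, inferInstance, inferInstance, inferInstance,
    inferInstance, ?_⟩, ⟨(q.isColimit.coconePointsIsoOfNatIso hc (asIso t)).symm⟩⟩
  exact ObjectProperty.colimitsOfShape_le_of_final _
    (ULift.orderIso.{v} (α := ℕ)).equivalence.functor _
    ⟨.colimit (bassSystem M f) fun _ => ⟨Iso.refl M⟩⟩

end EnochsAdd

theorem mainTheorem4 {A : Type u} [Category.{v} A] [Preadditive A] [IsLocallyPresentable.{v} A]
    (M : A) (hM : THEC M) (hB : MainConjectureHolds (ModulesOver M) (freeOne M)) :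
    List.TFAE [
      IsCovering (addClass M),
      directLimits (addClass M) ≤ hasCover (addClass M),
      countableDirectLimits (copies M) ≤ hasCover (addClass M),
      countableDirectLimits (copies M) ≤ addClass M,
      ClosedUnderDirectLimits (addClass M),
      IsCovering (isProjective (ModulesOver M)),
      directLimits (isProjective (ModulesOver M)) ≤ hasCover (isProjective (ModulesOver M)),
      countableDirectLimits (copies (freeOne M)) ≤ hasCover (isProjective (ModulesOver M)),
      countableDirectLimits (copies (freeOne M)) ≤ isProjective (ModulesOver M),
      ClosedUnderDirectLimits (isProjective (ModulesOver M))] := by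
  have hdirect {C : Type _} [Category.{v} C] (L : ObjectProperty C) :
      countableDirectLimits L ≤ directLimits L :=
    fun X ⟨Θ, h₁, h₂, h₃, _, h₅⟩ => ⟨Θ, h₁, h₂, h₃, h₅⟩
  have hcopies : countableDirectLimits (copies M) ≤ directLimits (addClass M) :=
    fun X hX => by
      obtain ⟨Θ, h₁, h₂, h₃, h₄⟩ := hdirect _ X hX
      exact ⟨Θ, h₁, h₂, h₃, ObjectProperty.colimitsOfShape_monotone _ copies_le_addClass _ h₄⟩
  tfae_have 1 → 2 := fun h X _ => h X
  tfae_have 2 → 3 := fun h X hX => h X (hcopies X hX)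
  tfae_have 5 → 4 := fun h X hX => h X (hcopies X hX)
  tfae_have 4 → 3 := fun h X hX => le_hasCover _ X (h X hX)
  tfae_have 6 → 1 := fun h D => (hasCover_addClass_iff D).2 (h _)
  tfae_have 10 → 5 := closedUnderDirectLimits_addClass
  tfae_have 3 → 8 := fun h Y hY => by
    obtain ⟨D, hD, ⟨e⟩⟩ := exists_iso_of_countableDirectLimits hM hY
    exact hasCover_of_iso _ e ((hasCover_addClass_iff D).1 (h D hD))
  tfae_have 6 ↔ 7 := hB.out 0 1
  tfae_have 7 ↔ 8 := hB.out 1 2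
  tfae_have 8 ↔ 9 := hB.out 2 3
  tfae_have 9 ↔ 10 := hB.out 3 4
  tfae_finish
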